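/- **Conventions.** Order $\mathbb{Z}^n$ right-lexicographically (the last coordinate in which two tuples differ decides), and write $1=(1,0,\dots,0)$ for its least positive element. For $k<n$ regard $\mathbb{Z}^k\subset\mathbb{Z}^n$ as the convex subgroup of tuples whose coordinates after the $k$-th vanish. Let $X$ be a set and $X^{\pm}=X\sqcup X^{-1}$. *Words.* A $\mathbb{Z}^n$-word over $X$ is a function $w:[1,|w|]\to X^{\pm}$ with $|w|\in\mathbb{Z}^n$, $|w|\ge 0$; $\varepsilon$ is the empty word. Concatenation $uv$ and inversion $w^{-1}(\beta)=w(|w|+1-\beta)^{-1}$ are defined as for finite words. The word $w$ is reduced if $w(\beta+1)\ne w(\beta)^{-1}$ for $1\le\beta<|w|$; $R(\mathbb{Z}^n,X)$ is the set of reduced words. Let $\mathrm{com}(u,v)$ be the longest common initial subword of $u,v$, if it exists, and $c(u,v)=|\mathrm{com}(u,v)|$. If $c=\mathrm{com}(u^{-1},v)$ exists, write $u=u_1c^{-1}$, $v=cv_1$ and put $u*v=u_1v_1$. $CDR(\mathbb{Z}^n,X)$ is the set of reduced words of the form $c^{-1}uc$ with $c,u$ reduced and $u$ either empty or with $u(1)^{-1}\neq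 u(|u|)$. A subgroup of $CDR(\mathbb{Z}^n,X)$ is a non-empty subset on which $*$ is everywhere defined and which is closed under $*$ and inversion and is a group under these operations. A $\mathbb{Z}^n$-free group is a group $G$ realized as a subgroup of $CDR(\mathbb{Z}^n,X)$ for some set $X$. It is *irreducible* if there are no $k<n$ and $u\in R(\mathbb{Z}^n,X)$ such that $g\mapsto (u^{-1}*g)*u$ is everywhere defined on $G$ and identifies $G$ with a subgroup of $CDR(\mathbb{Z}^k,X)$. *The tree.* The universal $\mathbb{Z}^n$-tree $\Gamma_G$ is the set of pairs $(\alpha,g)$ with $g\in G$, $0\le\alpha\le|g|$, modulo $(\alpha,f)\sim(\beta,g)\iff\alpha=\beta\le c(f,g)$; equivalently, it is the set of initial subwords of elements of $G$. It has base point $\varepsilon$ and metric $d(x,y)=|x|+|y|-2c(x,y)$, and $G$ acts on it by isometries $g\cdot x=g*x$. *Ends.* An end of $\mathbb{Z}^n$-type of $\Gamma_G$ is an equivalence class of isometries $\gamma:[0,\infty)_{\mathbb{Z}^n}\to\Gamma_G$, two of them being equivalent if they have a common terminal subray. Let $\partial_n\Gamma_G$ be the set of these ends, with the induced $G$-action and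 the topology generated by the cones $U_x$ ($x\in\Gamma_G$), where $U_x$ is the set of ends represented by a ray that starts at $\varepsilon$ and contains $[\varepsilon,x]$. **Theorem.** Let $G$ be a finitely generated, irreducible, non-abelian $\mathbb{Z}^n$-free group. Then $G$ acts on $\partial_n\Gamma_G$ by homeomorphisms, and this action is minimal: for every $p\in\partial_n\Gamma_G$ the orbit $G\cdot p$ is dense in $\partial_n\Gamma_G$. -/

import Mathlib

open Topology

namespace ZnFree

/-! ### The ordered group `ℤⁿ` -/

/-- `ℤⁿ` with the right lexicographic order: the last coordinate in which two tuples differ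
decides. -/
def Zn (n : ℕ) : Type := Colex (Fin n → ℤ)

noncomputable instance (n : ℕ) : LinearOrder (Zn n) :=
  inferInstanceAs (LinearOrder (Colex (Fin n → ℤ)))

instance (n : ℕ) : AddCommGroup (Zn n) := inferInstanceAs (AddCommGroup (Fin n → ℤ))

/-- The coordinates of an element of `ℤⁿ`. -/
def Zn.coord {n : ℕ} (a : Zn n) (i : Fin n) : ℤ := ofColex (a : Colex (Fin n → ℤ)) i

theorem Zn.lt_iff {n : ℕ} (a b : Zn n) :
    a < b ↔ ∃ i, (∀ j, i < j → a.coord j = b.coord j) ∧ a.coord i < b.coord i := Iff.rfl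

instance (n : ℕ) : IsOrderedAddMonoid (Zn n) where
  add_le_add_left a b hab c := by
    rcases hab.eq_or_lt with rfl | h
    · exact le_rfl
    · refine le_of_lt ?_
      obtain ⟨i, hi, hlt⟩ := h
      refine ⟨i, fun j hj => ?_, ?_⟩
      · exact congrArg (· + c.coord j) (hi j hj)
      · exact Int.add_lt_add_right hlt (c.coord i)

/-- The minimal positive element `(1, 0, …, 0)` of `ℤⁿ`. -/
def unit (n : ℕ) : Zn n := toColex (fun i : Fin n => if i.val = 0 then (1 : ℤ) else 0)

theorem pos_iff_unit_le {m : ℕ} (β : Zn (m + 1)) : 0 < β ↔ unit (m + 1) ≤ β := by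
  have hu : ∀ i, (unit (m + 1)).coord i = if i.val = 0 then 1 else 0 := fun _ => rfl
  have hz : ∀ i, (0 : Zn (m + 1)).coord i = 0 := fun _ => rfl
  have h1 : (0 : Zn (m + 1)) < unit (m + 1) := by
    refine (Zn.lt_iff _ _).2 ⟨0, fun j hj => ?_, ?_⟩
    · have h0 : j.val ≠ 0 := Nat.pos_iff_ne_zero.1 hj
      rw [hu, hz, if_neg h0]
    · rw [hu, hz]
      simp
  refine ⟨fun h => ?_, fun h => lt_of_lt_of_le h1 h⟩
  by_contra hlt
  obtain ⟨i, hi, hpos⟩ := (Zn.lt_iff _ _).1 h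
  obtain ⟨j, hj, hneg⟩ := (Zn.lt_iff _ _).1 (lt_of_not_ge hlt)
  simp only [hu, hz] at hi hj hpos hneg
  rcases lt_trichotomy i j with hij | hij | hij
  · have h0 : j.val ≠ 0 := by
      have : i.val < j.val := hij
      omega
    rw [← hi j hij, if_neg h0] at hneg
    exact lt_irrefl _ hneg
  · subst hij
    split_ifs at hneg <;> omega
  · have h0 : i.val ≠ 0 := by
      have : j.val < i.val := hij
      omega
    have := hj i hij
    rw [if_neg h0] at this
    omega

/-! ### Infinite words -/

/-- The inverse of a letter of `X^±`; the letter `x` is `(x, true)` and `x⁻¹` is `(x, false)`. -/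
def letterInv {X : Type*} (a : X × Bool) : X × Bool := (a.1, !a.2)

/-- A `ℤⁿ`-word over `X`: a function `[1, |w|] → X^±` with `|w| ≥ 0`. The function is given as a
partial function on `ℤⁿ` with domain `{β | 0 < β ≤ |w|} = [1, |w|]`. -/
@[ext]
structure Word (n : ℕ) (X : Type*) where
  /-- the length `|w|` -/
  len : Zn n
  len_nonneg : 0 ≤ len
  /-- the letter at a given position -/
  letter : Zn n → Option (X × Bool)
  isSome_letter : ∀ β, (letter β).isSome ↔ 0 < β ∧ β ≤ len

namespace Word

variable {n : ℕ} {X : Type*}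

/-- The empty word `ε`. -/
def nil : Word n X where
  len := 0
  len_nonneg := le_rfl
  letter _ := none
  isSome_letter β := by
    simp only [Option.isSome_none, Bool.false_eq_true, false_iff, not_and, not_le]
    exact id

/-- The inverse word, `w⁻¹(β) = w(|w| + 1 - β)⁻¹`. -/
def inv (w : Word n X) : Word n X where
  len := w.len
  len_nonneg := w.len_nonneg
  letter β := (w.letter (w.len + unit n - β)).map letterInv
  isSome_letter β := by
    rw [Option.isSome_map, w.isSome_letter]
    cases n with
    | zero =>
      have h : ∀ a b : Zn 0, a = b := fun a b => funext fun i => i.elim0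
      rw [h (w.len + unit 0 - β) 0, h β 0]
    | succ m =>
      rw [pos_iff_unit_le, pos_iff_unit_le β, le_sub_iff_add_le', sub_le_iff_le_add',
        add_le_add_iff_right, add_comm β, add_le_add_iff_left]
      tauto

/-- The concatenation `u v`. -/
noncomputable def append (u v : Word n X) : Word n X where
  len := u.len + v.len
  len_nonneg := add_nonneg u.len_nonneg v.len_nonneg
  letter β := if β ≤ u.len then u.letter β else v.letter (β - u.len)
  isSome_letter β := by
    have hu := u.len_nonneg
    have hv := v.len_nonneg
    split_ifs with h
    · rw [u.isSome_letter]
      have := h.trans (le_add_of_nonneg_right hv)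
      tauto
    · rw [v.isSome_letter, sub_pos, sub_le_iff_le_add']
      have h' := lt_of_not_ge h
      have := hu.trans_lt h'
      tauto

/-- Truncation of an element of `ℤⁿ` to the segment `[0, |w|]`. -/
noncomputable def clamp (w : Word n X) (α : Zn n) : Zn n := max 0 (min α w.len)

/-- The initial subword of `w` of length `α`, for `α ∈ [0, |w|]`. -/
noncomputable def take (w : Word n X) (α : Zn n) : Word n X where
  len := w.clamp α
  len_nonneg := le_max_left _ _
  letter β := if β ≤ w.clamp α then w.letter β else none
  isSome_letter β := by
    have h1 : w.clamp α ≤ w.len := max_le w.len_nonneg (min_le_right _ _)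
    split_ifs with h
    · rw [w.isSome_letter]
      have := h.trans h1
      tauto
    · simp [h]

/-- What remains of `w` after deleting its initial subword of length `α`, for `α ∈ [0, |w|]`. -/
noncomputable def drop (w : Word n X) (α : Zn n) : Word n X where
  len := w.len - w.clamp α
  len_nonneg := sub_nonneg.2 (max_le w.len_nonneg (min_le_right _ _))
  letter β := if 0 < β then w.letter (β + w.clamp α) else none
  isSome_letter β := by
    have h1 : 0 ≤ w.clamp α := le_max_left _ _
    split_ifs with h
    · rw [w.isSome_letter, le_sub_iff_add_le]
      have := add_pos_of_pos_of_nonneg h h1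
      tauto
    · simp [h]

/-- A word is reduced if it has no subword `x x⁻¹`, `x ∈ X^±`. -/
def Reduced (w : Word n X) : Prop :=
  ∀ β, unit n ≤ β → β < w.len → w.letter (β + unit n) ≠ (w.letter β).map letterInv

/-- `x` is an initial subword of `w`. -/
def IsPrefix (x w : Word n X) : Prop :=
  x.len ≤ w.len ∧ ∀ β ≤ x.len, x.letter β = w.letter β

/-- The lengths of the common initial subwords of `u` and `v`. -/
def commonLengths (u v : Word n X) : Set (Zn n) :=
  {γ | 0 ≤ γ ∧ γ ≤ u.len ∧ γ ≤ v.len ∧ ∀ β ≤ γ, u.letter β = v.letter β}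

/-- `com(u, v)`, the longest common initial subword of `u` and `v`, exists. -/
def HasCom (u v : Word n X) : Prop := ∃ γ, IsGreatest (commonLengths u v) γ

open Classical in
/-- `c(u, v)`, the length of `com(u, v)` (and `0` if `com(u, v)` does not exist). -/
noncomputable def comLen (u v : Word n X) : Zn n :=
  if h : HasCom u v then h.choose else 0

/-- The partial product `u ∗ v` is defined. -/
def MulDefined (u v : Word n X) : Prop := HasCom u.inv v

/-- The product `u ∗ v`, meaningful if `MulDefined u v`: if `u = u₁ c⁻¹` and `v = c v₁` with
`c = com(u⁻¹, v)`, then `u ∗ v = u₁ v₁`. -/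
noncomputable def mul (u v : Word n X) : Word n X :=
  (u.take (u.len - comLen u.inv v)).append (v.drop (comLen u.inv v))

/-- `v` is cyclically reduced: `v(1)⁻¹ ≠ v(|v|)` (no condition for the empty word). -/
def CyclicallyReduced (v : Word n X) : Prop :=
  v.len = 0 ∨ (v.letter (unit n)).map letterInv ≠ v.letter v.len

/-- Membership in `CDR(ℤⁿ, X)`: `v` is reduced and `v = c⁻¹ ∘ u ∘ c` with `u` cyclically
reduced. -/
def CDR (v : Word n X) : Prop :=
  v.Reduced ∧ ∃ c u : Word n X, c.Reduced ∧ u.Reduced ∧ u.CyclicallyReduced ∧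
    v = (c.inv.append u).append c

/-- `v` is a word over `ℤᵏ`, where `ℤᵏ ⊆ ℤⁿ` is the convex subgroup of all tuples whose
coordinates after the `k`-th vanish. -/
def IsZkWord (k : ℕ) (v : Word n X) : Prop := ∀ i : Fin n, k ≤ i.val → v.len.coord i = 0

/-- The tree metric between two words, `|u| + |v| - 2 c(u, v)`. -/
noncomputable def dist (u v : Word n X) : Zn n := u.len + v.len - 2 • comLen u v

theorem comLen_spec {u v : Word n X} (h : HasCom u v) :
    IsGreatest (commonLengths u v) (comLen u v) := by
  rw [comLen, dif_pos h]
  exact h.choose_spec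

theorem comLen_eq {u v : Word n X} {γ : Zn n} (h : IsGreatest (commonLengths u v) γ) :
    comLen u v = γ := (comLen_spec ⟨γ, h⟩).unique h

theorem comLen_bounds (u v : Word n X) :
    0 ≤ comLen u v ∧ comLen u v ≤ u.len ∧ comLen u v ≤ v.len := by
  by_cases h : HasCom u v
  · obtain ⟨⟨a, b, c, _⟩, _⟩ := comLen_spec h
    exact ⟨a, b, c⟩
  · rw [comLen, dif_neg h]
    exact ⟨le_rfl, u.len_nonneg, v.len_nonneg⟩

theorem commonLengths_comm (u v : Word n X) : commonLengths u v = commonLengths v u := by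
  ext γ
  constructor <;> rintro ⟨a, b, c, d⟩ <;> exact ⟨a, c, b, fun β hβ => (d β hβ).symm⟩

theorem comLen_comm (u v : Word n X) : comLen u v = comLen v u := by
  unfold comLen HasCom
  rw [commonLengths_comm]

theorem mem_commonLengths_iff {u v : Word n X} (h : HasCom u v) (γ : Zn n) :
    γ ∈ commonLengths u v ↔ 0 ≤ γ ∧ γ ≤ comLen u v := by
  obtain ⟨⟨a, b, c, d⟩, e⟩ := comLen_spec h
  refine ⟨fun hγ => ⟨hγ.1, e hγ⟩, fun hγ => ⟨hγ.1, hγ.2.trans b, hγ.2.trans c, ?_⟩⟩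
  exact fun β hβ => d β (hβ.trans hγ.2)

theorem comLen_ultra {u v w : Word n X} (huv : HasCom u v) (hvw : HasCom v w) (huw : HasCom u w) :
    min (comLen u v) (comLen v w) ≤ comLen u w := by
  obtain ⟨⟨a, b, c, d⟩, -⟩ := comLen_spec huv
  obtain ⟨⟨a', b', c', d'⟩, -⟩ := comLen_spec hvw
  obtain ⟨-, e⟩ := comLen_spec huw
  refine e ⟨le_min a a', (min_le_left _ _).trans b, (min_le_right _ _).trans c', ?_⟩
  intro β hβ
  exact (d β (hβ.trans (min_le_left _ _))).trans (d' β (hβ.trans (min_le_right _ _)))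

theorem isGreatest_of_prefix {x y u v : Word n X} (hx : x.IsPrefix u) (hy : y.IsPrefix v)
    (h : HasCom u v) :
    IsGreatest (commonLengths x y) (min (min x.len y.len) (comLen u v)) := by
  obtain ⟨⟨a, b, c, d⟩, e⟩ := comLen_spec h
  constructor
  · refine ⟨le_min (le_min x.len_nonneg y.len_nonneg) a, ?_, ?_, ?_⟩
    · exact (min_le_left _ _).trans (min_le_left _ _)
    · exact (min_le_left _ _).trans (min_le_right _ _)
    · intro β hβ
      simp only [le_min_iff] at hβ
      rw [hx.2 β hβ.1.1, hy.2 β hβ.1.2, d β hβ.2]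
  · rintro γ ⟨p, q, r, s⟩
    refine le_min (le_min q r) (e ⟨p, q.trans hx.1, r.trans hy.1, fun β hβ => ?_⟩)
    rw [← hx.2 β (hβ.trans q), ← hy.2 β (hβ.trans r), s β hβ]

theorem IsPrefix.refl (u : Word n X) : u.IsPrefix u := ⟨le_rfl, fun _ _ => rfl⟩

theorem mul_len (u v : Word n X) :
    (mul u v).len = (u.len - comLen u.inv v) + (v.len - comLen u.inv v) := by
  obtain ⟨a, b, c⟩ := comLen_bounds u.inv v
  change _ ≤ u.len at b
  simp only [mul, append, take, drop, clamp]
  rw [min_eq_left c, max_eq_right a, min_eq_left (sub_le_self _ a), max_eq_right (sub_nonneg.2 b)]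

theorem mul_letter (u v : Word n X) (β : Zn n) :
    (mul u v).letter β = if β ≤ u.len - comLen u.inv v then u.letter β
      else v.letter (β - (u.len - comLen u.inv v) + comLen u.inv v) := by
  obtain ⟨a, b, c⟩ := comLen_bounds u.inv v
  change _ ≤ u.len at b
  have h1 : u.clamp (u.len - comLen u.inv v) = u.len - comLen u.inv v := by
    rw [clamp, min_eq_left (sub_le_self _ a), max_eq_right (sub_nonneg.2 b)]
  have h2 : v.clamp (comLen u.inv v) = comLen u.inv v := by
    rw [clamp, min_eq_left c, max_eq_right a]
  change (if β ≤ u.clamp _ then (if β ≤ u.clamp _ then u.letter β else none) else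
    (if 0 < β - u.clamp _ then v.letter (β - u.clamp _ + v.clamp _) else none)) = _
  simp only [h1, h2]
  split_ifs with h3 h4
  · rfl
  · rfl
  · exact absurd (sub_pos.2 (lt_of_not_ge h3)) h4

/-- Two words of the same length with the same letters up to that length are equal. -/
theorem ext_of_le {u v : Word n X} (h : u.len = v.len)
    (h' : ∀ β ≤ u.len, u.letter β = v.letter β) : u = v := by
  refine Word.ext h (funext fun β => ?_)
  by_cases hβ : β ≤ u.len
  · exact h' β hβ
  · have h1 : ¬ (u.letter β).isSome := fun hh => hβ ((u.isSome_letter β).1 hh).2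
    have h2 : ¬ (v.letter β).isSome := fun hh => hβ (h ▸ ((v.isSome_letter β).1 hh).2)
    rw [Option.not_isSome_iff_eq_none] at h1 h2
    rw [h1, h2]

end Word

/-! ### Subgroups of `CDR(ℤⁿ, X)` -/

/-- A realization of the group `G` as a subgroup of `CDR(ℤⁿ, X)`: an injective map from `G` to
`CDR(ℤⁿ, X)` whose image is closed under `∗` (everywhere defined on the image) and under inversion
of words, and which carries the operations of `G` to those of words. -/
structure WordRep (n : ℕ) (X G : Type*) [Group G] where
  /-- the word of a group element -/
  word : G → Word n X
  injective : Function.Injective word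
  cdr : ∀ g, (word g).CDR
  word_one : word 1 = Word.nil
  word_inv : ∀ g, word g⁻¹ = (word g).inv
  mulDefined : ∀ g h, (word g).MulDefined (word h)
  word_mul : ∀ g h, word (g * h) = (word g).mul (word h)

namespace WordRep

variable {n : ℕ} {X G : Type*} [Group G]

/-- `G` is reducible if it is conjugate in `R(ℤⁿ, X)` to a subgroup of `CDR(ℤᵏ, X)`, `k < n`. -/
def Reducible (φ : WordRep n X G) : Prop :=
  ∃ k < n, ∃ u : Word n X, u.Reduced ∧ ∃ ψ : WordRep n X G, ∀ g,
    u.inv.MulDefined (φ.word g) ∧ (u.inv.mul (φ.word g)).MulDefined u ∧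
    ψ.word g = (u.inv.mul (φ.word g)).mul u ∧ (ψ.word g).IsZkWord k

/-- The universal tree `Γ_G`. The point `⟨α, g⟩`, with `g ∈ G` and `α ∈ [0, |g|]`, is represented by
the initial subword of `g` of length `α`, so that `⟨α, f⟩ = ⟨β, g⟩` if and only if
`α = β ≤ c(f, g)`. -/
def Tree (φ : WordRep n X G) : Type _ := {x : Word n X // ∃ g, x.IsPrefix (φ.word g)}

variable {φ : WordRep n X G}

theorem hasCom (g h : G) : (φ.word g).HasCom (φ.word h) := by
  have := φ.mulDefined g⁻¹ h
  rwa [Word.MulDefined, ← φ.word_inv, inv_inv] at this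

/-! #### The action on the universal tree -/

/-- `|g⁻¹ h| = |g| + |h| - 2 c(g, h)`. -/
theorem len_inv_mul (g h : G) : (φ.word (g⁻¹ * h)).len =
    (φ.word g).len + (φ.word h).len - 2 • (φ.word g).comLen (φ.word h) := by
  have h1 : (φ.word g⁻¹).inv = φ.word g := by rw [← φ.word_inv, inv_inv]
  have h2 : (φ.word g⁻¹).len = (φ.word g).len := by rw [φ.word_inv]; rfl
  rw [φ.word_mul, Word.mul_len, h1, h2]
  abel

theorem comLen_inv_of_prefix (g : G) {k : G} {x : Word n X} (hx : x.IsPrefix (φ.word k)) :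
    (φ.word g).inv.comLen x = min x.len ((φ.word g⁻¹).comLen (φ.word k)) := by
  rw [← φ.word_inv, Word.comLen_eq
    (Word.isGreatest_of_prefix (Word.IsPrefix.refl (φ.word g⁻¹)) hx (hasCom g⁻¹ k))]
  have := (Word.comLen_bounds (φ.word g⁻¹) (φ.word k)).2.1
  rw [min_assoc, min_eq_right ((min_le_right _ _).trans this)]

theorem mul_prefix_of_le (g : G) {k : G} {x : Word n X} (hx : x.IsPrefix (φ.word k))
    (h : x.len ≤ (φ.word g⁻¹).comLen (φ.word k)) :
    ((φ.word g).mul x).IsPrefix (φ.word g) ∧ ((φ.word g).mul x).len = (φ.word g).len - x.len := by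
  have hc := comLen_inv_of_prefix g hx
  rw [min_eq_left h] at hc
  have hl : ((φ.word g).mul x).len = (φ.word g).len - x.len := by
    rw [Word.mul_len, hc, sub_self, add_zero]
  refine ⟨⟨hl.trans_le (sub_le_self _ x.len_nonneg), fun β hβ => ?_⟩, hl⟩
  rw [Word.mul_letter, hc, if_pos (hl ▸ hβ)]

theorem mul_prefix_of_ge (g : G) {k : G} {x : Word n X} (hx : x.IsPrefix (φ.word k))
    (h : (φ.word g⁻¹).comLen (φ.word k) ≤ x.len) :
    ((φ.word g).mul x).IsPrefix (φ.word (g * k)) ∧ ((φ.word g).mul x).len =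
      (φ.word g).len + x.len - 2 • (φ.word g⁻¹).comLen (φ.word k) := by
  have hc := comLen_inv_of_prefix g hx
  rw [min_eq_right h] at hc
  have hk : (φ.word g).inv.comLen (φ.word k) = (φ.word g⁻¹).comLen (φ.word k) := by
    rw [φ.word_inv]
  have hl : ((φ.word g).mul x).len =
      (φ.word g).len + x.len - 2 • (φ.word g⁻¹).comLen (φ.word k) := by
    rw [Word.mul_len, hc]
    abel
  refine ⟨⟨?_, fun β hβ => ?_⟩, hl⟩
  · rw [φ.word_mul, Word.mul_len, Word.mul_len, hc, hk]
    exact add_le_add_right (sub_le_sub_right hx.1 _) _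
  · rw [φ.word_mul, Word.mul_letter, Word.mul_letter, hc, hk]
    split_ifs with h1
    · rfl
    · refine hx.2 _ ?_
      rw [hl] at hβ
      generalize (φ.word g⁻¹).comLen (φ.word k) = c at *
      have h3 : β - ((φ.word g).len - c) + c = β - ((φ.word g).len - 2 • c) := by abel
      rw [h3, sub_le_iff_le_add]
      refine hβ.trans_eq ?_
      abel

namespace Tree

variable (φ) in
/-- The base point `ε = ⟨0, 1⟩` of `Γ_G`. -/
def base : Tree φ := ⟨Word.nil, 1, by rw [φ.word_one]; exact Word.IsPrefix.refl _⟩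

variable (φ) in
/-- The point `g · ε = ⟨|g|, g⟩` of `Γ_G`. -/
def vertex (g : G) : Tree φ := ⟨φ.word g, g, Word.IsPrefix.refl _⟩

/-- The `ℤⁿ`-metric of `Γ_G`. -/
noncomputable def dist (x y : Tree φ) : Zn n := x.1.dist y.1

/-- The action of `G` on `Γ_G`: the initial subword `x` of an element of `G` is sent by `g` to
`g ∗ x`. In terms of pairs, `g · ⟨α, k⟩` is `⟨|g| - α, g⟩` if `α ≤ c(g⁻¹, k)`, and
`⟨|g| + α - 2 c(g⁻¹, k), g ∗ k⟩` otherwise. -/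
noncomputable instance : SMul G (Tree φ) where
  smul g x := ⟨(φ.word g).mul x.1, by
    obtain ⟨k, hk⟩ := x.2
    rcases le_total x.1.len ((φ.word g⁻¹).comLen (φ.word k)) with h | h
    · exact ⟨g, (mul_prefix_of_le g hk h).1⟩
    · exact ⟨g * k, (mul_prefix_of_ge g hk h).1⟩⟩

theorem dist_comm (x y : Tree φ) : dist x y = dist y x := by
  unfold dist Word.dist
  rw [Word.comLen_comm, add_comm x.1.len]

theorem dist_of_prefix {x y : Tree φ} {k l : G} (hx : x.1.IsPrefix (φ.word k))
    (hy : y.1.IsPrefix (φ.word l)) : dist x y = x.1.len + y.1.len -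
      2 • min (min x.1.len y.1.len) ((φ.word k).comLen (φ.word l)) := by
  unfold dist Word.dist
  rw [Word.comLen_eq (Word.isGreatest_of_prefix hx hy (hasCom k l))]

theorem dist_vertex {x : Tree φ} {k : G} (hx : x.1.IsPrefix (φ.word k)) (h : G) :
    dist x (vertex φ h) = x.1.len + (φ.word h).len -
      2 • min x.1.len ((φ.word k).comLen (φ.word h)) := by
  rw [dist_of_prefix hx (Word.IsPrefix.refl (φ.word h) : (vertex φ h).1.IsPrefix _)]
  have := (Word.comLen_bounds (φ.word k) (φ.word h)).2.2
  change _ + (φ.word h).len - 2 • min (min _ (φ.word h).len) _ = _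
  rw [min_assoc, min_eq_right this]

theorem arith_le {Λ : Type*} [AddCommGroup Λ] [LinearOrder Λ] [IsOrderedAddMonoid Λ]
    {g h gh α c₀ c₁ c₂ c₃ : Λ} (h₁ : gh = g + h - 2 • c₁) (h₃ : h = g + gh - 2 • c₃)
    (hα : α ≤ c₀) (u₁ : min c₀ c₂ ≤ c₁) (u₂ : min c₀ c₁ ≤ c₂) :
    (g - α) + gh - 2 • min (g - α) c₃ = α + h - 2 • min α c₂ := by
  grind

theorem arith_ge {Λ : Type*} [AddCommGroup Λ] [LinearOrder Λ] [IsOrderedAddMonoid Λ]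
    {g h k gh gk kh α c₀ c₁ c₂ c₃ : Λ} (h₁ : gh = g + h - 2 • c₁) (h₂ : gk = g + k - 2 • c₀)
    (h₃ : kh = gk + gh - 2 • c₃) (h₄ : kh = k + h - 2 • c₂) (hα : c₀ ≤ α)
    (u₁ : min c₀ c₂ ≤ c₁) (u₂ : min c₀ c₁ ≤ c₂) (u₃ : min c₁ c₂ ≤ c₀) :
    (g + α - 2 • c₀) + gh - 2 • min (g + α - 2 • c₀) c₃ = α + h - 2 • min α c₂ := by
  grind

theorem dist_smul_vertex (g : G) (x : Tree φ) (h : G) :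
    dist (g • x) (vertex φ (g * h)) = dist x (vertex φ h) := by
  obtain ⟨k, hk⟩ := x.2
  have l₁ := len_inv_mul (φ := φ) g⁻¹ h
  have l₂ := len_inv_mul (φ := φ) g⁻¹ k
  have li : (φ.word g⁻¹).len = (φ.word g).len := by rw [φ.word_inv]; rfl
  rw [inv_inv, li] at l₁ l₂
  have u₁ := Word.comLen_ultra (hasCom (φ := φ) g⁻¹ k) (hasCom k h) (hasCom g⁻¹ h)
  have u₂ := Word.comLen_ultra (hasCom (φ := φ) k g⁻¹) (hasCom g⁻¹ h) (hasCom k h)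
  have u₃ := Word.comLen_ultra (hasCom (φ := φ) g⁻¹ h) (hasCom h k) (hasCom g⁻¹ k)
  rw [Word.comLen_comm (φ.word k) (φ.word g⁻¹)] at u₂
  rw [Word.comLen_comm (φ.word h) (φ.word k)] at u₃
  rw [dist_vertex hk]
  rcases le_total x.1.len ((φ.word g⁻¹).comLen (φ.word k)) with hle | hle
  · obtain ⟨hp, hl⟩ := mul_prefix_of_le g hk hle
    have l₃ := len_inv_mul (φ := φ) g (g * h)
    rw [inv_mul_cancel_left] at l₃
    rw [dist_vertex (x := g • x) hp]
    change ((φ.word g).mul x.1).len + _ - 2 • min ((φ.word g).mul x.1).len _ = _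
    rw [hl]
    exact arith_le l₁ l₃ hle u₁ u₂
  · obtain ⟨hp, hl⟩ := mul_prefix_of_ge g hk hle
    have l₃ := len_inv_mul (φ := φ) (g * k) (g * h)
    rw [mul_inv_rev, mul_assoc, inv_mul_cancel_left] at l₃
    rw [dist_vertex (x := g • x) hp]
    change ((φ.word g).mul x.1).len + _ - 2 • min ((φ.word g).mul x.1).len _ = _
    rw [hl]
    exact arith_ge l₁ l₂ l₃ (len_inv_mul k h) hle u₁ u₂ u₃

theorem arith_sep {Λ : Type*} [AddCommGroup Λ] [LinearOrder Λ] [IsOrderedAddMonoid Λ]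
    {a b c k : Λ} (ha : a ≤ k) (hb : b = a) (h : a + k - 2 • min a k = b + k - 2 • min b c) :
    b ≤ c := by
  grind

/-- A point of `Γ_G` is determined by its distances to the orbit of the base point. -/
theorem eq_of_dist {x y : Tree φ} (h : ∀ g, dist x (vertex φ g) = dist y (vertex φ g)) :
    x = y := by
  obtain ⟨k, hk⟩ := x.2
  obtain ⟨l, hl⟩ := y.2
  have h1 := h 1
  rw [dist_vertex hk, dist_vertex hl] at h1
  have hz : ∀ g, (φ.word g).comLen (φ.word 1) = 0 := fun g => by
    obtain ⟨a, -, c⟩ := Word.comLen_bounds (φ.word g) (φ.word 1)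
    refine le_antisymm (c.trans_eq ?_) a
    rw [φ.word_one]
    rfl
  rw [hz, hz, min_eq_right x.1.len_nonneg, min_eq_right y.1.len_nonneg] at h1
  have hlen : x.1.len = y.1.len := by simpa using h1
  have h2 := h k
  have hkk : (φ.word k).comLen (φ.word k) = (φ.word k).len :=
    Word.comLen_eq ⟨⟨(φ.word k).len_nonneg, le_rfl, le_rfl, fun _ _ => rfl⟩, fun γ hγ => hγ.2.1⟩
  rw [dist_vertex hk, dist_vertex hl, hkk] at h2
  have h3 := arith_sep hk.1 hlen.symm h2
  obtain ⟨⟨-, -, -, d⟩, -⟩ := Word.comLen_spec (hasCom (φ := φ) l k)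
  refine Subtype.ext (Word.ext_of_le hlen fun β hβ => ?_)
  rw [hk.2 β hβ, hl.2 β (hlen ▸ hβ), d β ((hlen ▸ hβ : β ≤ y.1.len).trans h3)]

theorem dist_smul_vertex' (g : G) (x : Tree φ) (h : G) :
    dist (g • x) (vertex φ h) = dist x (vertex φ (g⁻¹ * h)) := by
  rw [← dist_smul_vertex g x, mul_inv_cancel_left]

noncomputable instance : MulAction G (Tree φ) where
  one_smul x := eq_of_dist fun h => by rw [dist_smul_vertex', inv_one, one_mul]
  mul_smul a b x := eq_of_dist fun h => by
    rw [dist_smul_vertex', dist_smul_vertex', dist_smul_vertex', mul_inv_rev, mul_assoc]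

theorem arith_upper {Λ : Type*} [AddCommGroup Λ] [LinearOrder Λ] [IsOrderedAddMonoid Λ]
    {x y g a b c : Λ} (u₁ : min a b ≤ c) (u₂ : min a c ≤ b)
    (u₃ : min b c ≤ a) :
    (x + g - 2 • min x b) - (y + g - 2 • min y c) ≤ x + y - 2 • min (min x y) a := by
  grind

theorem dist_sub_le (x y : Tree φ) (g : G) :
    dist x (vertex φ g) - dist y (vertex φ g) ≤ dist x y := by
  obtain ⟨k, hk⟩ := x.2
  obtain ⟨l, hl⟩ := y.2
  have u₁ := Word.comLen_ultra (hasCom (φ := φ) l k) (hasCom k g) (hasCom l g)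
  have u₂ := Word.comLen_ultra (hasCom (φ := φ) k l) (hasCom l g) (hasCom k g)
  have u₃ := Word.comLen_ultra (hasCom (φ := φ) k g) (hasCom g l) (hasCom k l)
  rw [Word.comLen_comm (φ.word l) (φ.word k)] at u₁
  rw [Word.comLen_comm (φ.word g) (φ.word l)] at u₃
  rw [dist_vertex hk, dist_vertex hl, dist_of_prefix hk hl]
  exact arith_upper u₁ u₂ u₃

theorem arith_attained {Λ : Type*} [AddCommGroup Λ] [LinearOrder Λ] [IsOrderedAddMonoid Λ]
    {x y k l a : Λ} (hx : x ≤ k) (hy : y ≤ l) :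
    x + y - 2 • min (min x y) a = (x + l - 2 • min x a) - (y + l - 2 • min y l) ∨
    x + y - 2 • min (min x y) a = (y + k - 2 • min y a) - (x + k - 2 • min x k) := by
  grind

theorem dist_attained (x y : Tree φ) : ∃ g,
    dist x y = dist x (vertex φ g) - dist y (vertex φ g) ∨
    dist x y = dist y (vertex φ g) - dist x (vertex φ g) := by
  obtain ⟨k, hk⟩ := x.2
  obtain ⟨l, hl⟩ := y.2
  have hself : ∀ g, (φ.word g).comLen (φ.word g) = (φ.word g).len := fun g =>
    Word.comLen_eq ⟨⟨(φ.word g).len_nonneg, le_rfl, le_rfl, fun _ _ => rfl⟩, fun γ hγ => hγ.2.1⟩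
  rcases arith_attained hk.1 hl.1 with h | h
  · refine ⟨l, Or.inl ?_⟩
    rw [dist_of_prefix hk hl, dist_vertex hk, dist_vertex hl, hself, h]
  · refine ⟨k, Or.inr ?_⟩
    rw [dist_of_prefix hk hl, dist_vertex hk, dist_vertex hl, hself,
      Word.comLen_comm (φ.word l), h]

theorem dist_le_smul (g : G) (x y : Tree φ) : dist x y ≤ dist (g • x) (g • y) := by
  obtain ⟨h, hh | hh⟩ := dist_attained x y
  · rw [hh, ← dist_smul_vertex g x, ← dist_smul_vertex g y]
    exact dist_sub_le (φ := φ) _ _ (g * h)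
  · rw [hh, ← dist_smul_vertex g x, ← dist_smul_vertex g y, dist_comm (g • x) (g • y)]
    exact dist_sub_le (φ := φ) _ _ (g * h)

/-- `G` acts on `Γ_G` by isometries. -/
theorem dist_smul (g : G) (x y : Tree φ) : dist (g • x) (g • y) = dist x y := by
  refine le_antisymm ?_ (dist_le_smul g x y)
  have := dist_le_smul g⁻¹ (g • x) (g • y)
  rwa [inv_smul_smul, inv_smul_smul] at this

/-- The segment `[x, y]` of the tree. -/
def segment (x y : Tree φ) : Set (Tree φ) := {z | dist x z + dist z y = dist x y}

end Tree

/-! ### Ends of `ℤⁿ`-type -/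

/-- A geodesic ray of `ℤⁿ`-type: an isometry `[0, ∞)_{ℤⁿ} → Γ_G`. -/
@[ext]
structure Ray (φ : WordRep n X G) where
  /-- the point of the ray at a given distance from its origin -/
  point : {α : Zn n // 0 ≤ α} → Tree φ
  isometry : ∀ α β, (point α).dist (point β) = |α.1 - β.1|

namespace Ray

/-- The point of the ray at distance `α + δ` from its origin. -/
def shift (γ : Ray φ) (α δ : {α : Zn n // 0 ≤ α}) : Tree φ :=
  γ.point ⟨α.1 + δ.1, add_nonneg α.2 δ.2⟩

/-- Two rays are equivalent if they have a common terminal subray. -/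
def Equiv (γ γ' : Ray φ) : Prop := ∃ α β, ∀ δ, γ.shift α δ = γ'.shift β δ

instance setoid (φ : WordRep n X G) : Setoid (Ray φ) where
  r := Equiv
  iseqv :=
    { refl := fun _ => ⟨⟨0, le_rfl⟩, ⟨0, le_rfl⟩, fun _ => rfl⟩
      symm := fun ⟨α, β, h⟩ => ⟨β, α, fun δ => (h δ).symm⟩
      trans := by
        rintro γ₁ γ₂ γ₃ ⟨α, β, h⟩ ⟨β', κ, h'⟩
        have hs : ∀ (γ : Ray φ) (a b d : {α : Zn n // 0 ≤ α}),
            γ.shift ⟨a.1 + b.1, add_nonneg a.2 b.2⟩ d =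
              γ.shift a ⟨b.1 + d.1, add_nonneg b.2 d.2⟩ := by
          intro γ a b d
          unfold shift
          congr 2
          exact add_assoc _ _ _
        refine ⟨⟨α.1 + β'.1, add_nonneg α.2 β'.2⟩, ⟨κ.1 + β.1, add_nonneg κ.2 β.2⟩, fun δ => ?_⟩
        rw [hs, hs, h, ← h']
        unfold shift
        congr 2
        exact add_left_comm _ _ _ }

noncomputable instance : SMul G (Ray φ) where
  smul g γ := ⟨fun α => g • γ.point α, fun α β => by rw [Tree.dist_smul, γ.isometry]⟩

end Ray

/-- The set `∂ₙΓ_G` of ends of `ℤⁿ`-type. -/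
def End (φ : WordRep n X G) : Type _ := Quotient (Ray.setoid φ)

namespace End

/-- The action of `G` on `∂ₙΓ_G` induced by the action on `Γ_G`. -/
noncomputable instance : MulAction G (End φ) where
  smul g := Quotient.map (fun γ => g • γ) fun _ _ ⟨α, β, h⟩ =>
    ⟨α, β, fun δ => congrArg (fun x => g • x) (h δ)⟩
  one_smul e := by
    induction e using Quotient.inductionOn with
    | h γ =>
      have h : (1 : G) • γ = γ := Ray.ext (funext fun α => one_smul G (γ.point α))
      exact congrArg (Quotient.mk (Ray.setoid φ)) h
  mul_smul a b e := by
    induction e using Quotient.inductionOn with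
    | h γ =>
      have h : (a * b) • γ = a • b • γ := Ray.ext (funext fun α => mul_smul a b (γ.point α))
      exact congrArg (Quotient.mk (Ray.setoid φ)) h

/-- The cone `U_x`: all ends represented by a ray that starts at `ε` and contains `[ε, x]`. -/
def cone (x : Tree φ) : Set (End φ) :=
  {e | ∃ γ : Ray φ, ⟦γ⟧ = e ∧ γ.point ⟨0, le_rfl⟩ = Tree.base φ ∧
    Tree.segment (Tree.base φ) x ⊆ Set.range γ.point}

/-- The topology of `∂ₙΓ_G`, generated by the cones. -/
instance : TopologicalSpace (End φ) := TopologicalSpace.generateFrom (Set.range cone)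

end End

end WordRep

end ZnFree

namespace ZnFree

/-! Density only has to be tested on non-empty cones, which form a basis. Let $U_x$ be one and $p$
an end.

The action on the tree is free: $g*x=x$ makes $g$ agree with $g^{-1}$ up to its middle, where a
reduced word would have to cancel (`Tree.eq_one_of_smul_eq`). Elements fixing an end act far out on
a ray as translations; translations commute, so by freeness the stabilizer of an end is abelian
(`End.commute_of_fixed`). As $G$ is not abelian, some $k$ moves $p$. The rays from $\varepsilon$ to
$p$ and $kp$ have different points at some distance $\alpha$.

A ray through $x$ gives $h\in G$ that begins with $x$ and continues for at least $\alpha$ more. The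
word $h^{-1}$ has only one initial subword of length $\alpha$, so at least one of the two rays
leaves $h^{-1}$ before $\alpha$. Multiplying that ray by $h$ cancels at most $\alpha$ letters and
spares $x$, so $hp$ or $hkp$ lies in $U_x$ (`End.smul_mem_cone`).

Continuity has the same source: $g$ cancels at most $|g|$ letters, so it preserves the
initial-subword relation beyond length $|g|$ (`Tree.smul_isPrefix_smul`). -/

theorem unit_le_of_pos {n : ℕ} {β : Zn n} (h : 0 < β) : unit n ≤ β := by
  cases n with
  | zero =>
    have h0 : β = 0 := funext fun i => i.elim0
    exact absurd h (h0 ▸ lt_irrefl _)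
  | succ m => exact (pos_iff_unit_le β).1 h

/-! ### Initial subwords, and reduced words compared with their inverses -/

namespace Word

variable {n : ℕ} {X : Type*}

theorem IsPrefix.trans {u v w : Word n X} (h : u.IsPrefix v) (h' : v.IsPrefix w) :
    u.IsPrefix w :=
  ⟨h.1.trans h'.1, fun β hβ => (h.2 β hβ).trans (h'.2 β (hβ.trans h.1))⟩

theorem IsPrefix.of_le {u v w : Word n X} (hu : u.IsPrefix w) (hv : v.IsPrefix w)
    (h : u.len ≤ v.len) : u.IsPrefix v :=
  ⟨h, fun β hβ => (hu.2 β hβ).trans (hv.2 β (hβ.trans h)).symm⟩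

theorem IsPrefix.eq_of_len {u v w : Word n X} (hu : u.IsPrefix w) (hv : v.IsPrefix w)
    (h : u.len = v.len) : u = v :=
  ext_of_le h fun β hβ => (hu.2 β hβ).trans (hv.2 β (hβ.trans h.le)).symm

theorem IsPrefix.comLen_eq {u v : Word n X} (h : u.IsPrefix v) : u.comLen v = u.len :=
  Word.comLen_eq ⟨⟨u.len_nonneg, le_rfl, h.1, h.2⟩, fun _ hγ => hγ.2.1⟩

theorem IsPrefix.of_len_le_comLen {u v : Word n X} (h : HasCom u v) (hl : u.len ≤ u.comLen v) :
    u.IsPrefix v := by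
  obtain ⟨⟨-, -, c, d⟩, -⟩ := comLen_spec h
  exact ⟨hl.trans c, fun β hβ => d β (hβ.trans hl)⟩

theorem take_len {w : Word n X} {α : Zn n} (h0 : 0 ≤ α) (h : α ≤ w.len) :
    (w.take α).len = α := by
  change max 0 (min α w.len) = α
  rw [min_eq_left h, max_eq_right h0]

theorem take_isPrefix (w : Word n X) (α : Zn n) : (w.take α).IsPrefix w := by
  refine ⟨max_le w.len_nonneg (min_le_right _ _), fun β hβ => ?_⟩
  exact if_pos hβ

theorem nil_isPrefix (w : Word n X) : (nil : Word n X).IsPrefix w := by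
  refine ⟨w.len_nonneg, fun β hβ => ?_⟩
  have : ¬ (w.letter β).isSome := fun hh => not_lt_of_ge hβ ((w.isSome_letter β).1 hh).1
  rw [Option.not_isSome_iff_eq_none] at this
  exact this.symm

/-- A reduced word which agrees with its inverse up to half of its length is empty. -/
theorem Reduced.len_eq_zero {w : Word n X} (hw : w.Reduced) {c : Zn n} (hc : w.len = c + c)
    (h : ∀ β ≤ c, w.letter β = w.inv.letter β) : w.len = 0 := by
  have hc0 : 0 ≤ c := by
    by_contra hlt
    have h1 : c < 0 := lt_of_not_ge hlt
    exact not_lt_of_ge w.len_nonneg (hc ▸ add_neg h1 h1)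
  rcases hc0.eq_or_lt with rfl | hpos
  · rw [hc, add_zero]
  -- The contradiction sits in the middle: $w(c)=w^{-1}(c)=w(2c+1-c)^{-1}=w(c+1)^{-1}$.
  · refine absurd ?_ (hw c (unit_le_of_pos hpos) (hc ▸ lt_add_of_pos_left c hpos))
    rw [h c le_rfl]
    change _ = ((w.letter (w.len + unit n - c)).map letterInv).map letterInv
    have h1 : w.len + unit n - c = c + unit n := by rw [hc]; abel
    have h2 : (letterInv ∘ letterInv : X × Bool → X × Bool) = id := by
      funext a; simp [letterInv]
    rw [h1, Option.map_map, h2, Option.map_id, id]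

end Word

namespace WordRep

variable {n : ℕ} {X G : Type*} [Group G] {φ : WordRep n X G}

/-! ### Initial subwords in the tree, freeness, and cancellation -/

namespace Tree

theorem hasCom (x y : Tree φ) : x.1.HasCom y.1 := by
  obtain ⟨k, hk⟩ := x.2
  obtain ⟨l, hl⟩ := y.2
  exact ⟨_, Word.isGreatest_of_prefix hk hl (WordRep.hasCom k l)⟩

theorem hasCom_word (g : G) (x : Tree φ) : (φ.word g).HasCom x.1 :=
  hasCom (vertex φ g) x

theorem base_dist (x : Tree φ) : (base φ).dist x = x.1.len := by
  have h : (base φ).1.IsPrefix x.1 := Word.nil_isPrefix _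
  change (base φ).1.len + x.1.len - 2 • _ = _
  rw [h.comLen_eq]
  change (0 : Zn n) + x.1.len - 2 • (0 : Zn n) = _
  simp

theorem dist_of_isPrefix {x y : Tree φ} (h : x.1.IsPrefix y.1) :
    x.dist y = y.1.len - x.1.len := by
  change x.1.len + y.1.len - 2 • _ = _
  rw [h.comLen_eq]
  abel

theorem eq_of_double_eq {Λ : Type*} [AddCommGroup Λ] [LinearOrder Λ] [IsOrderedAddMonoid Λ]
    {a b c : Λ} (h : a + b - 2 • c = b - a) : a = c := by
  grind

/-- $|x|+|y|-2c(x,y)=|y|-|x|$ forces $c(x,y)=|x|$, there being no torsion. This is how isometry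
conditions on rays become statements about words. -/
theorem isPrefix_of_dist_eq {x y : Tree φ} (h : x.dist y = y.1.len - x.1.len) :
    x.1.IsPrefix y.1 :=
  Word.IsPrefix.of_len_le_comLen (hasCom x y) (eq_of_double_eq h).le

theorem isPrefix_of_mem_segment {x z : Tree φ} (h : z ∈ segment (base φ) x) :
    z.1.IsPrefix x.1 := by
  refine isPrefix_of_dist_eq ?_
  have h' : (base φ).dist z + z.dist x = (base φ).dist x := h
  rw [base_dist, base_dist] at h'
  exact eq_sub_of_add_eq' h'

theorem mem_segment_self (x : Tree φ) : x ∈ segment (base φ) x := by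
  change _ + _ = _
  rw [dist_of_isPrefix (Word.IsPrefix.refl x.1), sub_self, add_zero]

/-- `G` acts freely on `Γ_G`. -/
theorem eq_one_of_smul_eq {g : G} {x : Tree φ} (h : g • x = x) : g = 1 := by
  obtain ⟨c0, c1, c2⟩ := Word.comLen_bounds (φ.word g).inv x.1
  have hcom : (φ.word g).inv.HasCom x.1 := by
    rw [← φ.word_inv]
    exact hasCom_word g⁻¹ x
  obtain ⟨⟨-, -, -, hd⟩, -⟩ := Word.comLen_spec hcom
  have hmul : (φ.word g).mul x.1 = x.1 := congrArg Subtype.val h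
  have hlen := congrArg Word.len hmul
  have hlet := fun β => congrArg (fun w => Word.letter w β) hmul
  rw [Word.mul_len] at hlen
  simp only [Word.mul_letter] at hlet
  generalize (φ.word g).inv.comLen x.1 = c at *
  -- Comparing lengths in $g*x=x$ gives $|g|-2c=0$.
  have hl : (φ.word g).len = c + c := by
    have : (φ.word g).len = ((φ.word g).len - c + (x.1.len - c)) - x.1.len + (c + c) := by abel
    rw [this, hlen]
    abel
  -- Up to $c=|g|-c$ the product $g*x=x$ has the letters of $g$, while $x$ has those of $g^{-1}$.
  have h0 : (φ.word g).len = 0 := by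
    refine (φ.cdr g).1.len_eq_zero hl fun β hβ => ?_
    rw [hd β hβ, ← hlet β, if_pos]
    rwa [hl, add_sub_cancel_right]
  apply φ.injective
  rw [φ.word_one]
  exact Word.IsPrefix.eq_of_len (Word.IsPrefix.refl _) (Word.nil_isPrefix _) h0

/-- The cancellation in $g*x$ involves at most $|g|$ letters of $x$, so letters beyond these have no
influence on it. -/
theorem comLen_inv_eq_of_isPrefix (g : G) {x y : Tree φ} (h : x.1.IsPrefix y.1)
    (hg : (φ.word g).len ≤ x.1.len) :
    (φ.word g).inv.comLen x.1 = (φ.word g).inv.comLen y.1 := by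
  obtain ⟨k, hk⟩ := y.2
  rw [comLen_inv_of_prefix g (h.trans hk), comLen_inv_of_prefix g hk]
  have h1 : (φ.word g⁻¹).comLen (φ.word k) ≤ x.1.len := by
    refine (Word.comLen_bounds _ _).2.1.trans ?_
    rw [φ.word_inv]
    exact hg
  rw [min_eq_right h1, min_eq_right (h1.trans h.1)]

/-- Both products undergo the same cancellation, after which the remainders of $x$ and $y$ still
agree. The bound matters: a short $x$ may cancel entirely while $y$ cancels further. -/
theorem smul_isPrefix_smul (g : G) {x y : Tree φ} (h : x.1.IsPrefix y.1)
    (hg : (φ.word g).len ≤ x.1.len) : (g • x).1.IsPrefix (g • y).1 := by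
  have hc := comLen_inv_eq_of_isPrefix g h hg
  change ((φ.word g).mul x.1).IsPrefix ((φ.word g).mul y.1)
  refine ⟨?_, fun β hβ => ?_⟩
  · rw [Word.mul_len, Word.mul_len, hc]
    exact add_le_add_right (sub_le_sub_right h.1 _) _
  · rw [Word.mul_len] at hβ
    rw [Word.mul_letter, Word.mul_letter, ← hc]
    split_ifs with h1
    · rfl
    · refine h.2 _ ?_
      rw [← le_sub_iff_add_le, sub_le_iff_le_add']
      exact hβ

/-- An initial subword of `h` stays one of `h ∗ y` if it is not reached by the cancellation. -/
theorem isPrefix_smul {h : G} {x y : Tree φ} (hx : x.1.IsPrefix (φ.word h)) {α : Zn n}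
    (hα : (φ.word h⁻¹).comLen y.1 ≤ α) (hl : x.1.len + α ≤ (φ.word h).len) :
    x.1.IsPrefix (h • y).1 := by
  rw [φ.word_inv] at hα
  have h1 : x.1.len ≤ (φ.word h).len - (φ.word h).inv.comLen y.1 :=
    (le_sub_iff_add_le.2 hl).trans (sub_le_sub_left hα _)
  change x.1.IsPrefix ((φ.word h).mul y.1)
  refine ⟨?_, fun β hβ => ?_⟩
  · rw [Word.mul_len]
    exact h1.trans (le_add_of_nonneg_right (sub_nonneg.2 (Word.comLen_bounds _ _).2.2))
  · rw [Word.mul_letter, if_pos (hβ.trans h1)]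
    exact hx.2 β hβ

theorem prefix_mem (y : Tree φ) (α : Zn n) : ∃ g, (y.1.take α).IsPrefix (φ.word g) := by
  obtain ⟨k, hk⟩ := y.2
  exact ⟨k, (Word.take_isPrefix _ _).trans hk⟩

/-- The initial segment of length `α` of a point of `Γ_G`. -/
noncomputable def take (y : Tree φ) (α : Zn n) : Tree φ := ⟨y.1.take α, prefix_mem y α⟩

end Tree

/-! ### Rays, and moving their origin to the base point -/

namespace Ray

/-- The points of a ray as a function on `ℤⁿ`, constant on the negative elements. -/
noncomputable def pt (γ : Ray φ) (α : Zn n) : Tree φ := γ.point ⟨max 0 α, le_max_left _ _⟩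

theorem point_eq_pt (γ : Ray φ) (α : {α : Zn n // 0 ≤ α}) : γ.point α = γ.pt α.1 :=
  congrArg γ.point (Subtype.ext (max_eq_right α.2).symm)

theorem dist_pt (γ : Ray φ) {α β : Zn n} (hα : 0 ≤ α) (hαβ : α ≤ β) :
    (γ.pt α).dist (γ.pt β) = β - α := by
  rw [pt, pt, γ.isometry]
  simp only [max_eq_right hα, max_eq_right (hα.trans hαβ)]
  rw [abs_sub_comm, abs_of_nonneg (sub_nonneg.2 hαβ)]

theorem smul_pt (g : G) (γ : Ray φ) (α : Zn n) : (g • γ).pt α = g • γ.pt α := rfl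

theorem equiv_iff {γ γ' : Ray φ} :
    γ.Equiv γ' ↔ ∃ α β : Zn n, 0 ≤ α ∧ 0 ≤ β ∧ ∀ δ, 0 ≤ δ → γ.pt (α + δ) = γ'.pt (β + δ) := by
  constructor
  · rintro ⟨α, β, h⟩
    refine ⟨α.1, β.1, α.2, β.2, fun δ hδ => ?_⟩
    have := h ⟨δ, hδ⟩
    rwa [shift, shift, point_eq_pt, point_eq_pt] at this
  · rintro ⟨α, β, hα, hβ, h⟩
    refine ⟨⟨α, hα⟩, ⟨β, hβ⟩, fun δ => ?_⟩
    rw [shift, shift, point_eq_pt, point_eq_pt]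
    exact h δ.1 δ.2

/-- The ray starts at the base point. -/
def Based (γ : Ray φ) : Prop := γ.point ⟨0, le_rfl⟩ = Tree.base φ

theorem Based.pt_len {γ : Ray φ} (h : γ.Based) {α : Zn n} (hα : 0 ≤ α) :
    (γ.pt α).1.len = α := by
  have h0 : γ.pt 0 = Tree.base φ := by rw [← h, point_eq_pt]
  rw [← Tree.base_dist, ← h0, γ.dist_pt le_rfl hα, sub_zero]

theorem Based.isPrefix {γ : Ray φ} (h : γ.Based) {α β : Zn n} (hα : 0 ≤ α) (hαβ : α ≤ β) :
    (γ.pt α).1.IsPrefix (γ.pt β).1 := by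
  refine Tree.isPrefix_of_dist_eq ?_
  rw [γ.dist_pt hα hαβ, h.pt_len hα, h.pt_len (hα.trans hαβ)]

theorem Based.pt_eq {γ : Ray φ} (h : γ.Based) {x : Tree φ} {α : Zn n} (hα : 0 ≤ α)
    (hx : x.1.IsPrefix (γ.pt α).1) : γ.pt x.1.len = x := by
  have hl : x.1.len ≤ α := hx.1.trans_eq (h.pt_len hα)
  exact Subtype.ext ((h.isPrefix x.1.len_nonneg hl).eq_of_len hx (h.pt_len x.1.len_nonneg))

/-- $D$, `La`, `Lb` are the lengths of $\gamma(0)$, $\gamma(\alpha)$, $\gamma(\beta)$; `ca`, `cb`,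
`c` are their overlaps. From $\alpha\ge D$ one gets `La` $\ge$ 2`ca`. If `ca` $\ne$ `cb`, the
smaller one equals `c`, and the distances then give `La` $<$ `ca` or `La` $=$ `ca` $>0$, both
impossible. -/
theorem arith_stable {Λ : Type*} [AddCommGroup Λ] [LinearOrder Λ] [IsOrderedAddMonoid Λ]
    {D α β La Lb ca cb c : Λ} (hα : D ≤ α) (ha0 : 0 ≤ ca) (hb0 : 0 ≤ cb)
    (ha : α = D + La - 2 • ca) (hb : β = D + Lb - 2 • cb)
    (h : β - α = La + Lb - 2 • c)
    (u₁ : min ca cb ≤ c) (u₂ : min ca c ≤ cb) (u₃ : min c cb ≤ ca) : ca = cb := by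
  grind

/-- Far out, every ray moves away from the base point. -/
theorem stable (γ : Ray φ) {α β : Zn n} (hα : (γ.pt 0).1.len ≤ α) (hαβ : α ≤ β) :
    (γ.pt β).1.len = (γ.pt α).1.len + (β - α) := by
  have hα0 := (γ.pt 0).1.len_nonneg.trans hα
  have ha := γ.dist_pt le_rfl hα0
  have hb := γ.dist_pt le_rfl (hα0.trans hαβ)
  have hab := γ.dist_pt hα0 hαβ
  rw [sub_zero] at ha hb
  unfold Tree.dist Word.dist at ha hb hab
  have c1 := Tree.hasCom (γ.pt 0) (γ.pt α)
  have c2 := Tree.hasCom (γ.pt 0) (γ.pt β)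
  have c3 := Tree.hasCom (γ.pt α) (γ.pt β)
  have u₁ := Word.comLen_ultra (Tree.hasCom (γ.pt α) (γ.pt 0)) c2 c3
  have u₂ := Word.comLen_ultra c1 c3 c2
  have u₃ := Word.comLen_ultra c2 (Tree.hasCom (γ.pt β) (γ.pt α)) c1
  rw [Word.comLen_comm (γ.pt α).1 (γ.pt 0).1] at u₁
  rw [Word.comLen_comm (γ.pt β).1 (γ.pt α).1, min_comm] at u₃
  have hc := arith_stable hα (Word.comLen_bounds _ _).1 (Word.comLen_bounds _ _).1 ha.symm hb.symm
    hab.symm u₁ u₂ u₃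
  rw [hc] at ha
  nth_rewrite 2 [← ha]
  nth_rewrite 2 [← hb]
  abel

theorem stable_isPrefix (γ : Ray φ) {α β : Zn n} (hα : (γ.pt 0).1.len ≤ α) (hαβ : α ≤ β) :
    (γ.pt α).1.IsPrefix (γ.pt β).1 := by
  refine Tree.isPrefix_of_dist_eq ?_
  rw [γ.dist_pt ((γ.pt 0).1.len_nonneg.trans hα) hαβ, γ.stable hα hαβ, add_sub_cancel_left]

/-- Ensures that the truncation in `rebasePt` really has length $\alpha$, since `take` clamps its
argument. -/
theorem le_len_pt (γ : Ray φ) {α : Zn n} (hα : 0 ≤ α) :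
    α ≤ (γ.pt ((γ.pt 0).1.len + α)).1.len := by
  rw [γ.stable le_rfl (le_add_of_nonneg_right hα), add_sub_cancel_left]
  exact le_add_of_nonneg_left (Word.len_nonneg _)

/-- The point at distance `α` from the base point on the way to the end of the ray. -/
noncomputable def rebasePt (γ : Ray φ) (α : Zn n) : Tree φ :=
  (γ.pt ((γ.pt 0).1.len + α)).take α

theorem rebasePt_len (γ : Ray φ) {α : Zn n} (hα : 0 ≤ α) : (γ.rebasePt α).1.len = α :=
  Word.take_len hα (γ.le_len_pt hα)

theorem rebasePt_isPrefix_pt (γ : Ray φ) {α β : Zn n} (hα : 0 ≤ α)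
    (h : (γ.pt 0).1.len + α ≤ β) : (γ.rebasePt α).1.IsPrefix (γ.pt β).1 :=
  (Word.take_isPrefix _ _).trans (γ.stable_isPrefix (le_add_of_nonneg_right hα) h)

theorem dist_rebasePt (γ : Ray φ) {α β : Zn n} (hα : 0 ≤ α) (h : α ≤ β) :
    (γ.rebasePt α).dist (γ.rebasePt β) = β - α := by
  have hβ := hα.trans h
  rw [Tree.dist_of_isPrefix, γ.rebasePt_len hα, γ.rebasePt_len hβ]
  refine (γ.rebasePt_isPrefix_pt hα (add_le_add_right h _)).of_le
    (γ.rebasePt_isPrefix_pt hβ le_rfl) ?_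
  rwa [γ.rebasePt_len hα, γ.rebasePt_len hβ]

/-- The ray from the base point to the end of a given ray. -/
noncomputable def rebase (γ : Ray φ) : Ray φ where
  point α := γ.rebasePt α.1
  isometry α β := by
    rcases le_total α.1 β.1 with h | h
    · rw [γ.dist_rebasePt α.2 h, abs_sub_comm, abs_of_nonneg (sub_nonneg.2 h)]
    · rw [Tree.dist_comm, γ.dist_rebasePt β.2 h, abs_of_nonneg (sub_nonneg.2 h)]

theorem rebase_based (γ : Ray φ) : γ.rebase.Based :=
  Subtype.ext (Word.IsPrefix.eq_of_len (Word.IsPrefix.refl _) (Word.nil_isPrefix _)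
    (γ.rebasePt_len le_rfl))

/-- From time $D=|\gamma(0)|$ on, $\gamma$ runs through growing initial subwords. So
$\gamma(D+\delta)$, of length $L+\delta$ with $L=|\gamma(D)|$, is the point of the rebased ray at
time $L+\delta$. -/
theorem rebase_equiv (γ : Ray φ) : γ.rebase.Equiv γ := by
  refine equiv_iff.2 ⟨(γ.pt (γ.pt 0).1.len).1.len, (γ.pt 0).1.len, Word.len_nonneg _,
    Word.len_nonneg _, fun δ hδ => ?_⟩
  set D := (γ.pt 0).1.len with hD
  set L := (γ.pt D).1.len with hL
  have hL0 : 0 ≤ L := Word.len_nonneg _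
  have h0 : 0 ≤ L + δ := add_nonneg hL0 hδ
  have h1 : γ.rebase.pt (L + δ) = γ.rebasePt (L + δ) := by
    change γ.rebasePt (max 0 (L + δ)) = _
    rw [max_eq_right h0]
  rw [h1]
  have h2 : D + δ ≤ D + (L + δ) := add_le_add_right (le_add_of_nonneg_left hL0) D
  refine Subtype.ext ((γ.rebasePt_isPrefix_pt h0 le_rfl).eq_of_len
    (γ.stable_isPrefix (le_add_of_nonneg_right hδ) h2) ?_)
  rw [γ.rebasePt_len h0, γ.stable le_rfl (le_add_of_nonneg_right hδ), add_sub_cancel_left]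

end Ray

/-- The end represented by a ray. -/
def Ray.toEnd (γ : Ray φ) : End φ := Quotient.mk (Ray.setoid φ) γ

/-! ### Cones as a basis, and continuity of the action -/

namespace End

theorem exists_toEnd (e : End φ) : ∃ γ : Ray φ, γ.toEnd = e := Quotient.exists_rep e


theorem exists_based (e : End φ) : ∃ γ : Ray φ, γ.Based ∧ γ.toEnd = e := by
  obtain ⟨γ, rfl⟩ := exists_toEnd e
  exact ⟨γ.rebase, γ.rebase_based, Quotient.sound γ.rebase_equiv⟩

theorem smul_mk (g : G) (γ : Ray φ) : g • γ.toEnd = (g • γ).toEnd := rfl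

theorem mem_cone_of_based {γ : Ray φ} (h : γ.Based) {x : Tree φ} {α : Zn n} (hα : 0 ≤ α)
    (hx : x.1.IsPrefix (γ.pt α).1) : γ.toEnd ∈ cone x := by
  refine ⟨γ, rfl, h, fun z hz => ?_⟩
  refine ⟨⟨z.1.len, z.1.len_nonneg⟩, ?_⟩
  rw [Ray.point_eq_pt]
  exact h.pt_eq hα ((Tree.isPrefix_of_mem_segment hz).trans hx)

theorem exists_based_of_mem_cone {e : End φ} {x : Tree φ} (he : e ∈ cone x) :
    ∃ γ : Ray φ, γ.Based ∧ γ.toEnd = e ∧ γ.pt x.1.len = x := by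
  obtain ⟨γ, h1, h2, h3⟩ := he
  obtain ⟨α, hα⟩ := h3 (Tree.mem_segment_self x)
  rw [Ray.point_eq_pt] at hα
  refine ⟨γ, h2, h1, Ray.Based.pt_eq h2 α.2 ?_⟩
  rw [hα]
  exact Word.IsPrefix.refl _

/-- An end lies in `U_x` if and only if far out any ray representing it lies beyond `x`. -/
theorem mk_mem_cone_iff {γ : Ray φ} {x : Tree φ} :
    γ.toEnd ∈ cone x ↔ ∃ α, ∀ β, α ≤ β → x.1.IsPrefix (γ.pt β).1 := by
  constructor
  · intro h
    obtain ⟨ρ, hρ, he, hx⟩ := exists_based_of_mem_cone h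
    obtain ⟨a, b, ha, hb, hab⟩ := Ray.equiv_iff.1 (Quotient.exact he)
    -- The based ray $\rho$ meets $x$ at time $|x|$, and $\gamma(\beta)=\rho(a+\beta-b)$ with
    -- $a+\beta-b\ge|x|$.
    refine ⟨b + x.1.len, fun β hβ => ?_⟩
    have h1 : x.1.len ≤ β - b := le_sub_iff_add_le'.2 hβ
    have h2 := hab (β - b) (x.1.len_nonneg.trans h1)
    rw [add_sub_cancel] at h2
    have h3 := hρ.isPrefix x.1.len_nonneg (h1.trans (le_add_of_nonneg_left ha))
    rwa [h2, hx] at h3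
  · rintro ⟨α, h⟩
    obtain ⟨a, b, ha, hb, hab⟩ := Ray.equiv_iff.1 γ.rebase_equiv
    have h0 : 0 ≤ max 0 α := le_max_left _ _
    have h1 : γ.rebase.toEnd = γ.toEnd := Quotient.sound γ.rebase_equiv
    rw [← h1]
    refine mem_cone_of_based γ.rebase_based (add_nonneg ha h0) ?_
    rw [hab _ h0]
    exact h _ ((le_max_right 0 α).trans (le_add_of_nonneg_left hb))

theorem cone_subset_of_isPrefix {x y : Tree φ} (h : x.1.IsPrefix y.1) : cone y ⊆ cone x := by
  intro e he
  obtain ⟨γ, rfl⟩ := exists_toEnd e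
  obtain ⟨α, hα⟩ := mk_mem_cone_iff.1 he
  exact mk_mem_cone_iff.2 ⟨α, fun β hβ => h.trans (hα β hβ)⟩

variable (φ) in
-- Cones sharing an end are nested: both vertices are initial subwords of a far point of one ray,
-- hence comparable.
theorem isTopologicalBasis_cone :
    TopologicalSpace.IsTopologicalBasis (Set.range (cone (φ := φ))) where
  exists_subset_inter := by
    rintro _ ⟨x, rfl⟩ _ ⟨y, rfl⟩ e ⟨hx, hy⟩
    have hx' := hx
    have hy' := hy
    obtain ⟨γ, rfl⟩ := exists_toEnd e
    obtain ⟨α, hα⟩ := mk_mem_cone_iff.1 hx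
    obtain ⟨β, hβ⟩ := mk_mem_cone_iff.1 hy
    have h1 := hα _ (le_max_left α β)
    have h2 := hβ _ (le_max_right α β)
    rcases le_total x.1.len y.1.len with h | h
    · exact ⟨cone y, ⟨y, rfl⟩, hy', fun _ he =>
        ⟨cone_subset_of_isPrefix (h1.of_le h2 h) he, he⟩⟩
    · exact ⟨cone x, ⟨x, rfl⟩, hx', fun _ he =>
        ⟨he, cone_subset_of_isPrefix (h2.of_le h1 h) he⟩⟩
  sUnion_eq := by
    refine Set.eq_univ_of_forall fun e => ⟨cone (Tree.base φ), ⟨_, rfl⟩, ?_⟩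
    obtain ⟨γ, rfl⟩ := exists_toEnd e
    exact mk_mem_cone_iff.2 ⟨0, fun _ _ => Word.nil_isPrefix _⟩
  eq_generateFrom := rfl

theorem isOpen_cone (x : Tree φ) : IsOpen (cone x) :=
  (isTopologicalBasis_cone φ).isOpen ⟨x, rfl⟩

/-- Every element of `G` acts continuously on `∂ₙΓ_G`. -/
theorem continuous_smul (g : G) : Continuous fun e : End φ => g • e := by
  refine (isTopologicalBasis_cone φ).continuous_iff.2 ?_
  rintro _ ⟨x, rfl⟩
  refine isOpen_iff_mem_nhds.2 fun e he => ?_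
  obtain ⟨γ, hγ, rfl⟩ := exists_based e
  change g • γ.toEnd ∈ cone x at he
  rw [smul_mk, mk_mem_cone_iff] at he
  obtain ⟨α, hα⟩ := he
  -- Beyond $\alpha$ the image ray lies past $x$; beyond $|g|$ the action of $g$ respects initial
  -- subwords. So $g$ maps the cone at $\gamma(T)$ into $U_x$.
  set T := max α (φ.word g).len with hT
  have hgT : (φ.word g).len ≤ T := le_max_right _ _
  have hT0 : 0 ≤ T := (φ.word g).len_nonneg.trans hgT
  have hlen := hγ.pt_len hT0
  refine Filter.mem_of_superset ((isOpen_cone (γ.pt T)).mem_nhds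
    (mem_cone_of_based hγ hT0 (Word.IsPrefix.refl _))) fun e' he' => ?_
  obtain ⟨γ', rfl⟩ := exists_toEnd e'
  obtain ⟨β, hβ⟩ := mk_mem_cone_iff.1 he'
  refine mk_mem_cone_iff.2 ⟨β, fun t ht => ?_⟩
  exact (hα T (le_max_left _ _)).trans
    (Tree.smul_isPrefix_smul g (hβ t ht) (hgT.trans_eq hlen.symm))

/-! ### Stabilizers of ends -/

/-- A common terminal subray of $\gamma$ and $g\gamma$ starts at times $b$ and $a$ respectively; the
shift $b-a$ may have either sign. -/
theorem exists_shift_of_smul_eq {g : G} {γ : Ray φ} (h : g • γ.toEnd = γ.toEnd) :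
    ∃ τ T : Zn n, ∀ t, T ≤ t → g • γ.pt t = γ.pt (t + τ) := by
  rw [smul_mk] at h
  obtain ⟨a, b, -, -, hab⟩ := Ray.equiv_iff.1 (Quotient.exact h)
  refine ⟨b - a, a, fun t ht => ?_⟩
  have h1 := hab (t - a) (sub_nonneg.2 ht)
  rw [add_sub_cancel, Ray.smul_pt] at h1
  rw [h1]
  congr 1
  abel

/-- Two elements of `G` with a common fixed end commute. -/
theorem commute_of_fixed {e : End φ} {a b : G} (ha : a • e = e) (hb : b • e = e) :
    a * b = b * a := by
  obtain ⟨γ, rfl⟩ := exists_toEnd e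
  obtain ⟨s, S, hs⟩ := exists_shift_of_smul_eq ha
  obtain ⟨t, T, ht⟩ := exists_shift_of_smul_eq hb
  -- Far enough out that the two translations can be applied in either order.
  set r := max (max S (S - t)) (max T (T - s)) with hr
  have h1 : S ≤ r := (le_max_left _ _).trans (le_max_left _ _)
  have h2 : S ≤ r + t := sub_le_iff_le_add.1 ((le_max_right _ _).trans (le_max_left _ _))
  have h3 : T ≤ r := (le_max_left _ _).trans (le_max_right _ _)
  have h4 : T ≤ r + s := sub_le_iff_le_add.1 ((le_max_right _ _).trans (le_max_right _ _))
  have h5 : (a * b) • γ.pt r = (b * a) • γ.pt r := by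
    rw [mul_smul, mul_smul, ht r h3, hs r h1, hs _ h2, ht _ h4, add_right_comm]
  have h6 : (b * a)⁻¹ * (a * b) = 1 :=
    Tree.eq_one_of_smul_eq (x := γ.pt r) (by rw [mul_smul, h5, inv_smul_smul])
  exact (inv_mul_eq_one.1 h6).symm

/-! ### Minimality -/

/-- If `σ` leaves `h⁻¹` before `α` and `x` ends at least `α` before the end of `h`, then `h` maps
the end of `σ` into `U_x`. -/
theorem smul_mem_cone {h : G} {x : Tree φ} {σ : Ray φ} (hσ : σ.Based) {α : Zn n} (hα : 0 ≤ α)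
    (hx : x.1.IsPrefix (φ.word h)) (hl : x.1.len + α ≤ (φ.word h).len)
    (hn : ¬ (σ.pt α).1.IsPrefix (φ.word h⁻¹)) : h • σ.toEnd ∈ cone x := by
  rw [smul_mk, mk_mem_cone_iff]
  refine ⟨α, fun t ht => Tree.isPrefix_smul hx (α := α) ?_ hl⟩
  -- A cancellation longer than $\alpha$ would make $\sigma(\alpha)$ an initial subword of $h^{-1}$.
  by_contra hlt
  have hlt := (lt_of_not_ge hlt).le
  obtain ⟨⟨-, b, -, d⟩, -⟩ := Word.comLen_spec (Tree.hasCom_word h⁻¹ (σ.pt t))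
  refine hn ⟨(hσ.pt_len hα).trans_le (hlt.trans b), fun β hβ => ?_⟩
  rw [(hσ.isPrefix hα ht).2 β hβ, d β (hβ.trans ((hσ.pt_len hα).trans_le hlt))]

theorem exists_smul_mem_cone (hnonab : ∃ a b : G, a * b ≠ b * a) (p : End φ) {x : Tree φ}
    (hx : (cone x).Nonempty) : ∃ g : G, g • p ∈ cone x := by
  obtain ⟨k, hk⟩ : ∃ k : G, k • p ≠ p := by
    by_contra! hall
    obtain ⟨a, b, hab⟩ := hnonab
    exact hab (commute_of_fixed (hall a) (hall b))
  obtain ⟨γ, hγ, hp⟩ := exists_based p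
  obtain ⟨γ', hγ', hp'⟩ := exists_based (k • p)
  obtain ⟨α, hα⟩ : ∃ α : {α : Zn n // 0 ≤ α}, γ.pt α.1 ≠ γ'.pt α.1 := by
    by_contra! hall
    have : γ = γ' := Ray.ext (funext fun α => by
      rw [Ray.point_eq_pt, Ray.point_eq_pt, hall])
    exact hk (by rw [← hp', ← hp, this])
  obtain ⟨q, hq⟩ := hx
  obtain ⟨η, hη, -, hηx⟩ := exists_based_of_mem_cone hq
  have hle : x.1.len ≤ x.1.len + α.1 := le_add_of_nonneg_right α.2
  have hl0 := x.1.len_nonneg.trans hle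
  -- Non-emptiness of the cone enters here: the ray $\eta$ gives room $\alpha$ beyond $x$ inside an
  -- element of $G$, to be used up by cancellation.
  obtain ⟨h, hh⟩ := (η.pt (x.1.len + α.1)).2
  have hxh : x.1.IsPrefix (φ.word h) := by
    have := (hη.isPrefix x.1.len_nonneg hle).trans hh
    rwa [hηx] at this
  have hlen : x.1.len + α.1 ≤ (φ.word h).len := (hη.pt_len hl0).symm.trans_le hh.1
  -- The points at $\alpha$ differ but have equal length, so they cannot both be initial subwords of
  -- $h^{-1}$.
  by_cases h1 : (γ.pt α.1).1.IsPrefix (φ.word h⁻¹)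
  · have h2 : ¬ (γ'.pt α.1).1.IsPrefix (φ.word h⁻¹) := fun h2 =>
      hα (Subtype.ext (h1.eq_of_len h2 ((hγ.pt_len α.2).trans (hγ'.pt_len α.2).symm)))
    refine ⟨h * k, ?_⟩
    rw [mul_smul, ← hp']
    exact smul_mem_cone hγ' α.2 hxh hlen h2
  · refine ⟨h, ?_⟩
    rw [← hp]
    exact smul_mem_cone hγ α.2 hxh hlen h1

end End

end WordRep

end ZnFree

theorem mainTheorem6 {n : ℕ} {X G : Type*} [Group G] (φ : ZnFree.WordRep n X G)
    (hfg : Group.FG G) (hirr : ¬ φ.Reducible) (hnonab : ∃ a b : G, a * b ≠ b * a) :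
    ContinuousConstSMul G φ.End ∧ MulAction.IsMinimal G φ.End := by
  -- Continuity of every element suffices for homeomorphisms, as inverses act continuously too.
  refine ⟨⟨ZnFree.WordRep.End.continuous_smul⟩, ⟨fun p => ?_⟩⟩
  refine (ZnFree.WordRep.End.isTopologicalBasis_cone φ).dense_iff.2 ?_
  rintro _ ⟨x, rfl⟩ hx
  obtain ⟨g, hg⟩ := ZnFree.WordRep.End.exists_smul_mem_cone hnonab p hx
  exact ⟨g • p, hg, ⟨g, rfl⟩⟩
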